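/- Let $n\in\mathbb{N}$ and let $\mathcal{M}_n=\mathbb{C}^{n\times n}$. A linear map $\mathcal{E}:\mathcal{M}_n\to\mathcal{M}_n$ is \emph{positivity improving} if $\mathcal{E}(A)$ is positive definite for every nonzero positive semidefinite $A$; a positive linear map $\mathcal{E}$ is \emph{doubly stochastic} if $\mathcal{E}(\mathbb{1})=\mathcal{E}^*(\mathbb{1})=\mathbb{1}$, where $\mathcal{E}^*$ is the adjoint with respect to $\langle A,B\rangle=\operatorname{tr}(A^\dagger B)$. For $X,Y\in\mathcal{M}_n$ write $\mathcal{E}_{X,Y}(\cdot):=Y^\dagger\mathcal{E}(X\cdot X^\dagger)Y$. Let $\mathcal{P}_n$ be the set of positivity improving maps on $\mathcal{M}_n$, with the topology of the operator norm. For every $\mathcal{E}\in\mathcal{P}_n$ there is exactly one doubly stochastic map $S(\mathcal{E})$ of the form $\mathcal{E}_{X,Y}$ with positive definite $X,Y$ (the doubly stochastic scaling of $\mathcal{E}$), and $S$ is continuous on $\mathcal{P}_n$. Moreover, the scaling matrices can be chosen as continuous functions $\mathcal{E}\mapsto X(\mathcal{E})$, $\mathcal{E}\mapsto Y(\mathcal{E})$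 on $\mathcal{P}_n$ with positive definite values and $S(\mathcal{E})=\mathcal{E}_{X(\mathcal{E}),Y(\mathcal{E})}$; every other pair of positive definite matrices that scales $\mathcal{E}$ to a doubly stochastic map is $(tX(\mathcal{E}),t^{-1}Y(\mathcal{E}))$ for some $t>0$. If $X',Y'\in\mathcal{M}_n$ are arbitrary matrices such that $\mathcal{E}_{X',Y'}$ is doubly stochastic, then $X'=tX(\mathcal{E})U$ and $Y'=t^{-1}Y(\mathcal{E})V$ for some $t>0$ and unitaries $U,V$, so that $\mathcal{E}_{X',Y'}=V^\dagger S(\mathcal{E})(U\cdot U^\dagger)V$. -/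

import Mathlib

open Matrix
open scoped ComplexOrder

/-- The algebra `M_n` of complex `n × n` matrices. -/
abbrev CMat (n : ℕ) : Type := Matrix (Fin n) (Fin n) ℂ

/-- Linear maps `M_n → M_n`.  As `M_n` is finite-dimensional, every linear map is continuous; the
topology that Mathlib puts on this space is the one of the operator norm. -/
abbrev CMatMap (n : ℕ) : Type := CMat n →L[ℂ] CMat n

/-- `E` is a positive map: it sends positive semidefinite matrices to positive semidefinite ones. -/
def IsPositiveMap {n : ℕ} (E : CMatMap n) : Prop :=
  ∀ A : CMat n, A.PosSemidef → (E A).PosSemidef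

/-- `E` is positivity improving: it sends nonzero positive semidefinite matrices to positive
definite ones. -/
def IsPositivityImproving {n : ℕ} (E : CMatMap n) : Prop :=
  ∀ A : CMat n, A.PosSemidef → A ≠ 0 → (E A).PosDef

/-- The space of positivity improving maps, with the subspace topology. -/
abbrev PosImprovingMap (n : ℕ) : Type := {E : CMatMap n // IsPositivityImproving E}

/-- The value at `B` of the adjoint `E*` of `E` for the Hilbert-Schmidt inner product
`⟨A, B⟩ = tr (Aᴴ B)`, through its entries `⟨e_i e_jᴴ, E* B⟩ = ⟨E (e_i e_jᴴ), B⟩`. -/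
noncomputable def hsAdjoint {n : ℕ} (E : CMatMap n) (B : CMat n) : CMat n :=
  Matrix.of fun i j => ((E (Matrix.single i j 1))ᴴ * B).trace

/-- The defining property of the adjoint: `⟨A, E* B⟩ = ⟨E A, B⟩`. -/
theorem trace_hsAdjoint {n : ℕ} (E : CMatMap n) (A B : CMat n) :
    (Aᴴ * hsAdjoint E B).trace = ((E A)ᴴ * B).trace := by
  have hA : A = ∑ i, ∑ j, A i j • Matrix.single i j (1 : ℂ) := by
    conv_lhs => rw [Matrix.matrix_eq_sum_single A]
    simp [Matrix.smul_single]
  have h1 : ((E A)ᴴ * B).trace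
      = ∑ i, ∑ j, star (A i j) * ((E (Matrix.single i j 1))ᴴ * B).trace := by
    conv_lhs => rw [hA]
    simp only [map_sum, map_smul, Matrix.conjTranspose_sum, Matrix.sum_mul, Matrix.trace_sum,
      Matrix.conjTranspose_smul, Matrix.smul_mul, Matrix.trace_smul, smul_eq_mul]
  rw [h1]
  simp only [Matrix.trace, Matrix.diag, Matrix.mul_apply, Matrix.conjTranspose_apply,
    hsAdjoint, Matrix.of_apply]
  rw [Finset.sum_comm]

/-- A doubly stochastic map: positive, with `E(1) = 1` and `E*(1) = 1`. -/
structure IsDoublyStochasticMap {n : ℕ} (E : CMatMap n) : Prop where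
  positive : IsPositiveMap E
  map_one : E 1 = 1
  adjoint_one : hsAdjoint E 1 = 1

/-- The map `A ↦ Yᴴ E(X A Xᴴ) Y`, that is, `E` scaled by the matrices `X` and `Y`. -/
noncomputable def scaleMap {n : ℕ} (E : CMatMap n) (X Y : CMat n) : CMatMap n where
  toFun A := Yᴴ * E (X * A * Xᴴ) * Y
  map_add' A B := by simp [mul_add, add_mul]
  map_smul' c A := by simp
  cont := by fun_prop

/-! Everything reduces to the nonlinear operator `T(P) = (E*(E(P)⁻¹))⁻¹`. The scaling by `X, Y` is
doubly stochastic exactly when `P = X Xᴴ` is a positive definite fixed point of `T` and `Y Yᴴ =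
E(P)⁻¹` (`isDoublyStochasticMap_scaleMap_iff`). So only `X Xᴴ` and `Y Yᴴ` matter: positive definite
factors are their square roots, and arbitrary ones differ from these by unitaries.

Positivity improvement makes `T` strictly monotone, and `T` is homogeneous of degree one, so
Perron–Frobenius arguments apply. Minimizing `r` subject to `T(P) ≤ r P` yields an eigenvector, and
a trace identity forces the eigenvalue to be 1. Strict monotonicity makes the fixed ray unique.
Normalized to trace one, the fixed point is continuous in `E` because its graph is closed and
density matrices form a compact space. -/

section

variable {n : ℕ}

/-! ### Order, compactness and inversion for positive matrices -/

namespace Matrix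

open scoped MatrixOrder Matrix.Norms.L2Operator in
/-- Subtracting a small multiple of a Hermitian matrix keeps a positive definite matrix positive. -/
theorem PosDef.exists_pos_sub_smul_posSemidef {G B : CMat n} (hG : G.PosDef)
    (hB : B.IsHermitian) : ∃ ε : ℝ, 0 < ε ∧ (G - (ε : ℂ) • B).PosSemidef := by
  rcases isEmpty_or_nonempty (Fin n) with hn | hn
  · exact ⟨1, one_pos, by rw [Subsingleton.elim (G - _) 0]; exact PosSemidef.zero⟩
  have hs := isStrictlyPositive_iff_posDef.mpr hG
  obtain ⟨r, hr, hrG⟩ := (CFC.exists_pos_algebraMap_le_iff (a := G) hG.isHermitian).2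
    fun x hx => hs.spectrum_pos hx
  have hBn : B ≤ algebraMap ℝ (CMat n) ‖B‖ := IsSelfAdjoint.le_algebraMap_norm_self hB
  have hpos : 0 < ‖B‖ + 1 := by positivity
  -- Here `G ≥ r` and `B ≤ ‖B‖`; the added 1 covers `B = 0`.
  refine ⟨r / (‖B‖ + 1), by positivity, ?_⟩
  rw [← nonneg_iff_posSemidef, sub_nonneg]
  refine le_trans ?_ hrG
  have h1 : ((r / (‖B‖ + 1) : ℝ) : ℂ) • B = (r / (‖B‖ + 1)) • B := by
    ext i j; simp
  rw [h1]
  calc (r / (‖B‖ + 1)) • B ≤ (r / (‖B‖ + 1)) • algebraMap ℝ (CMat n) ‖B‖ :=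
        smul_le_smul_of_nonneg_left hBn (by positivity)
    _ = algebraMap ℝ (CMat n) (r / (‖B‖ + 1) * ‖B‖) := by
        rw [map_mul, Algebra.smul_def]
    _ ≤ algebraMap ℝ (CMat n) r := by
        apply algebraMap_mono
        rw [div_mul_eq_mul_div, div_le_iff₀ hpos]
        nlinarith

/-- Strict antitonicity of the matrix inverse. -/
theorem PosDef.inv_sub_inv {A B : CMat n} (hA : A.PosDef) (hBA : (B - A).PosDef) :
    (A⁻¹ - B⁻¹).PosDef := by
  set D := B - A with hD
  have hB : B = A + D := by simp [hD]
  have hAu := (isUnit_iff_isUnit_det _).1 hA.isUnit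
  have hDu := (isUnit_iff_isUnit_det _).1 hBA.isUnit
  have hBu := (isUnit_iff_isUnit_det _).1 (hA.add hBA).isUnit
  have h1 : (A * D⁻¹ * A + A).PosDef := by
    have := hBA.inv.mul_mul_conjTranspose_same (B := A)
      (Matrix.vecMul_injective_of_isUnit hA.isUnit)
    rw [hA.isHermitian.eq] at this
    exact this.add hA
  -- This closed form exhibits the difference as the inverse of a sum of positive definite matrices.
  have h2 : A⁻¹ - B⁻¹ = (A * D⁻¹ * A + A)⁻¹ := by
    symm
    apply Matrix.inv_eq_left_inv
    rw [hB]
    have e1 : A * D⁻¹ * A + A = (A + D) * D⁻¹ * A := by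
      rw [add_mul, add_mul, Matrix.mul_nonsing_inv _ hDu, Matrix.one_mul]
    have e2 : A⁻¹ - (A + D)⁻¹ = A⁻¹ * D * (A + D)⁻¹ := by
      have : A⁻¹ * D = A⁻¹ * (A + D) - 1 := by
        rw [mul_add, Matrix.nonsing_inv_mul _ hAu]; abel
      rw [this, sub_mul, Matrix.mul_assoc, Matrix.mul_nonsing_inv _ hBu]; simp
    rw [e1, e2]
    calc A⁻¹ * D * (A + D)⁻¹ * ((A + D) * D⁻¹ * A)
        = A⁻¹ * (D * (((A + D)⁻¹ * (A + D)) * D⁻¹)) * A := by simp only [Matrix.mul_assoc]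
      _ = 1 := by
        rw [Matrix.nonsing_inv_mul _ hBu, Matrix.one_mul, Matrix.mul_nonsing_inv _ hDu,
          Matrix.mul_one, Matrix.nonsing_inv_mul _ hAu]
  rw [h2]
  exact h1.inv

theorem PosDef.trace_mul_pos [Nonempty (Fin n)] {A B : CMat n} (hA : A.PosDef) (hB : B.PosDef) :
    0 < (A * B).trace := by
  open scoped MatrixOrder in
  obtain ⟨C, hC⟩ := CStarAlgebra.nonneg_iff_eq_star_mul_self.mp hB.posSemidef.nonneg
  have hCu : IsUnit C := by
    have := hB.isUnit
    rw [hC, isUnit_iff_isUnit_det, det_mul] at this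
    exact (isUnit_iff_isUnit_det _).2 (isUnit_of_mul_isUnit_right this)
  rw [hC, ← Matrix.mul_assoc, Matrix.trace_mul_comm, ← Matrix.mul_assoc]
  exact (hA.mul_mul_conjTranspose_same (B := C) (Matrix.vecMul_injective_of_isUnit hCu)).trace_pos

theorem PosDef.smul_ofReal {A : CMat n} (hA : A.PosDef) {t : ℝ} (ht : 0 < t) :
    ((t : ℂ) • A).PosDef := hA.smul (Complex.zero_lt_real.mpr ht)

theorem isClosed_posSemidef : IsClosed {A : CMat n | A.PosSemidef} := by
  simp only [posSemidef_iff_dotProduct_mulVec, Set.ofPred_and, Set.ofPred_forall]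
  refine IsClosed.inter ?_ (isClosed_iInter fun x => ?_)
  · exact isClosed_eq (by fun_prop) continuous_id
  · exact isClosed_le continuous_const (by fun_prop)

open scoped MatrixOrder in
-- The set is the image of the Hilbert–Schmidt unit sphere under `B ↦ Bᴴ * B`.
theorem isCompact_posSemidef_trace_eq_one :
    IsCompact {A : CMat n | A.PosSemidef ∧ A.trace = 1} := by
  have hK : IsCompact {B : CMat n | (Bᴴ * B).trace = 1} := by
    refine IsCompact.of_isClosed_subset (s := Set.univ.pi fun _ : Fin n => Set.univ.pi
      fun _ : Fin n => Metric.closedBall (0 : ℂ) 1)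
      (isCompact_univ_pi fun _ => isCompact_univ_pi fun _ => isCompact_closedBall _ _)
      (isClosed_eq (by fun_prop) continuous_const) ?_
    intro (B : CMat n) (hB : (Bᴴ * B).trace = 1) i _ j _
    have h : ∑ j, ∑ i, ‖B i j‖ ^ 2 = (1 : ℝ) := by
      have : (Bᴴ * B).trace = ((∑ j, ∑ i, ‖B i j‖ ^ 2 : ℝ) : ℂ) := by
        simp [Matrix.trace, Matrix.mul_apply, ← Complex.conj_mul']
      rw [this] at hB
      exact_mod_cast hB
    have h1 : ‖B i j‖ ^ 2 ≤ 1 := by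
      rw [← h]
      refine le_trans ?_ (Finset.single_le_sum (f := fun j => ∑ i, ‖B i j‖ ^ 2)
        (fun _ _ => by positivity) (Finset.mem_univ j))
      exact Finset.single_le_sum (f := fun i => ‖B i j‖ ^ 2) (fun _ _ => by positivity)
        (Finset.mem_univ i)
    rw [mem_closedBall_zero_iff]
    exact (sq_le_one_iff₀ (norm_nonneg _)).1 h1
  convert hK.image (f := fun B : CMat n => Bᴴ * B) (by fun_prop) using 1
  ext A
  constructor
  · rintro ⟨hA, hA1⟩
    obtain ⟨C, hC⟩ := CStarAlgebra.nonneg_iff_eq_star_mul_self.mp hA.nonneg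
    exact ⟨C, by rw [Set.mem_ofPred_eq, ← hA1, hC]; rfl, hC.symm⟩
  · rintro ⟨B, hB, rfl⟩
    exact ⟨posSemidef_conjTranspose_mul_self _, hB⟩

open scoped MatrixOrder in
theorem PosSemidef.eq_of_mul_self_eq {A B : CMat n} (hA : A.PosSemidef) (hB : B.PosSemidef)
    (h : A * A = B * B) : A = B := by
  rw [← CFC.sqrt_mul_self A hA.nonneg, h, CFC.sqrt_mul_self B hB.nonneg]

theorem continuousAt_inv_of_isUnit {A : CMat n} (hA : IsUnit A) :
    ContinuousAt (Inv.inv : CMat n → CMat n) A := by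
  refine continuousAt_matrix_inv A ?_
  obtain ⟨u, hu⟩ := (isUnit_iff_isUnit_det _).1 hA
  rw [← hu]
  exact NormedRing.inverse_continuousAt u

end Matrix

/-! ### Adjoints and scalings -/

theorem hsAdjoint_sub (E : CMatMap n) (A B : CMat n) :
    hsAdjoint E (A - B) = hsAdjoint E A - hsAdjoint E B := by
  ext i j; simp [hsAdjoint, mul_sub]

theorem hsAdjoint_smul (E : CMatMap n) (c : ℂ) (A : CMat n) :
    hsAdjoint E (c • A) = c • hsAdjoint E A := by
  ext i j; simp [hsAdjoint]

theorem hsAdjoint_scaleMap (E : CMatMap n) (X Y B : CMat n) :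
    hsAdjoint (scaleMap E X Y) B = Xᴴ * hsAdjoint E (Y * B * Yᴴ) * X := by
  ext i j
  have h : ∀ M : CMat n, M i j = ((single i j (1 : ℂ))ᴴ * M).trace := by
    intro M
    rw [conjTranspose_single, star_one, trace_single_mul]
    simp
  rw [h (Xᴴ * hsAdjoint E (Y * B * Yᴴ) * X)]
  have h2 := trace_hsAdjoint E (X * single i j 1 * Xᴴ) (Y * B * Yᴴ)
  calc hsAdjoint (scaleMap E X Y) B i j
      = (((Yᴴ * E (X * single i j 1 * Xᴴ) * Y))ᴴ * B).trace := rfl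
    _ = ((E (X * single i j 1 * Xᴴ))ᴴ * (Y * B * Yᴴ)).trace := by
      simp only [conjTranspose_mul, conjTranspose_conjTranspose]
      rw [Matrix.mul_assoc, Matrix.trace_mul_comm]
      simp only [Matrix.mul_assoc]
    _ = _ := by
      rw [← h2]
      simp only [conjTranspose_mul, conjTranspose_conjTranspose]
      rw [Matrix.mul_assoc, Matrix.trace_mul_comm]
      simp only [Matrix.mul_assoc]

theorem scaleMap_scaleMap (E : CMatMap n) (X Y U V : CMat n) :
    scaleMap (scaleMap E X Y) U V = scaleMap E (X * U) (Y * V) := by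
  ext1 A
  change Vᴴ * (Yᴴ * E (X * (U * A * Uᴴ) * Xᴴ) * Y) * V
    = (Y * V)ᴴ * E ((X * U) * A * (X * U)ᴴ) * (Y * V)
  simp only [conjTranspose_mul, Matrix.mul_assoc]

theorem scaleMap_smul (E : CMatMap n) (X Y : CMat n) {t : ℝ} (ht : t ≠ 0) :
    scaleMap E ((t : ℂ) • X) ((t⁻¹ : ℂ) • Y) = scaleMap E X Y := by
  ext1 A
  change ((t⁻¹ : ℂ) • Y)ᴴ * E (((t : ℂ) • X) * A * ((t : ℂ) • X)ᴴ) * ((t⁻¹ : ℂ) • Y)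
    = Yᴴ * E (X * A * Xᴴ) * Y
  have ht' : (t : ℂ) ≠ 0 := by exact_mod_cast ht
  simp only [conjTranspose_smul, Matrix.smul_mul, Matrix.mul_smul, map_smul, smul_smul]
  have : (star (t⁻¹ : ℂ)) = (t⁻¹ : ℂ) := by simp
  simp [this]
  field_simp
  simp

theorem IsPositivityImproving.posDef_of_posDef [Nonempty (Fin n)] {E : CMatMap n}
    (h : IsPositivityImproving E) {A : CMat n} (hA : A.PosDef) : (E A).PosDef :=
  h A hA.posSemidef fun h0 => by simpa [h0] using hA.trace_pos

/-- Testing on a vector `x` gives `tr(E(x xᴴ) B)`, the trace of a product of two positive definite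
matrices. -/
theorem IsPositivityImproving.hsAdjoint_posDef [Nonempty (Fin n)] {E : CMatMap n}
    (h : IsPositivityImproving E) {B : CMat n} (hB : B.PosDef) : (hsAdjoint E B).PosDef := by
  have key : ∀ x : Fin n → ℂ, x ≠ 0 → 0 < star x ⬝ᵥ (hsAdjoint E B *ᵥ x) := by
    intro x hx
    have h1 : star x ⬝ᵥ (hsAdjoint E B *ᵥ x)
        = ((vecMulVec x (star x))ᴴ * hsAdjoint E B).trace := by
      rw [(posSemidef_vecMulVec_self_star x).isHermitian.eq, vecMulVec_mul, trace_vecMulVec,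
        dotProduct_mulVec, dotProduct_comm]
    have h2 : (E (vecMulVec x (star x))).PosDef := by
      refine h _ (posSemidef_vecMulVec_self_star x) fun h0 => hx ?_
      simpa using h0
    rw [h1, trace_hsAdjoint, h2.isHermitian.eq]
    exact h2.trace_mul_pos hB
  refine PosDef.of_dotProduct_mulVec_pos ?_ fun {x} hx => key x hx
  rw [← isSymmetric_toEuclideanLin_iff, LinearMap.isSymmetric_iff_inner_map_self_real]
  intro x
  rcases eq_or_ne x.ofLp 0 with hx | hx
  · obtain rfl : x = 0 := WithLp.ofLp_injective 2 hx
    simp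
  · have h1 : inner ℂ (toEuclideanLin (hsAdjoint E B) x) x
        = star (star x.ofLp ⬝ᵥ (hsAdjoint E B *ᵥ x.ofLp)) := by
      rw [EuclideanSpace.inner_eq_star_dotProduct, ofLp_toLpLin, toLin'_apply, dotProduct_comm,
        star_dotProduct]
    rw [h1, ← Complex.star_def, star_star, Complex.star_def]
    exact (Complex.conj_eq_iff_im.2 (Complex.pos_iff.1 (key _ hx)).2.symm).symm

/-! ### Density matrices and continuity -/

/-- The preimage of a closed set is the projection of a closed part of the graph, and projecting
along a compact factor is a closed map. -/
theorem continuous_of_isClosed_graph_of_compactSpace {X Y : Type*} [TopologicalSpace X]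
    [TopologicalSpace Y] [CompactSpace Y] {f : X → Y}
    (h : IsClosed {p : X × Y | f p.1 = p.2}) : Continuous f := by
  refine continuous_iff_isClosed.2 fun C hC => ?_
  convert isClosedMap_fst_of_compactSpace _ (h.inter (hC.preimage continuous_snd))
  ext x
  simp

/-- Positive semidefinite matrices of trace one. -/
abbrev DensityMatrix (n : ℕ) : Type := {A : CMat n // A.PosSemidef ∧ A.trace = 1}

instance : CompactSpace (DensityMatrix n) :=
  isCompact_iff_compactSpace.1 isCompact_posSemidef_trace_eq_one

theorem DensityMatrix.ne_zero (P : DensityMatrix n) : P.1 ≠ 0 := by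
  intro h
  simpa [h] using P.2.2

theorem CMatMap.apply_eq_sum (E : CMatMap n) (A : CMat n) :
    E A = ∑ i, ∑ j, A i j • E (single i j 1) := by
  conv_lhs => rw [Matrix.matrix_eq_sum_single A]
  simp only [map_sum, ← map_smul, Matrix.smul_single, smul_eq_mul, mul_one]

theorem CMatMap.continuous_apply {X : Type*} [TopologicalSpace X] {f : X → CMatMap n}
    {g : X → CMat n} (hf : Continuous f) (hg : Continuous g) :
    Continuous fun x => f x (g x) := by
  have h : (fun x => f x (g x)) = fun x => ∑ i, ∑ j, g x i j • f x (single i j 1) :=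
    funext fun x => (f x).apply_eq_sum (g x)
  rw [h]
  refine continuous_finsetSum _ fun i _ => continuous_finsetSum _ fun j _ => ?_
  exact (hg.matrix_elem i j).smul ((continuous_eval_const (single i j (1 : ℂ))).comp hf)

theorem continuous_hsAdjoint {X : Type*} [TopologicalSpace X] {f : X → CMatMap n}
    {g : X → CMat n} (hf : Continuous f) (hg : Continuous g) :
    Continuous fun x => hsAdjoint (f x) (g x) := by
  refine continuous_matrix fun i j => ?_
  have h := CMatMap.continuous_apply hf (continuous_const (y := single i j (1 : ℂ)))
  exact (h.matrix_conjTranspose.matrix_mul hg).matrix_trace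

theorem Matrix.continuous_inv_of_isUnit {X : Type*} [TopologicalSpace X] {g : X → CMat n}
    (hg : Continuous g) (hu : ∀ x, IsUnit (g x)) : Continuous fun x => (g x)⁻¹ :=
  continuous_iff_continuousAt.2 fun x =>
    (continuousAt_inv_of_isUnit (hu x)).comp hg.continuousAt

open scoped Matrix.Norms.Elementwise in
theorem CMatMap.continuous_of_apply {X : Type*} [TopologicalSpace X] {f : X → CMatMap n}
    (h : ∀ A, Continuous fun x => f x A) : Continuous f :=
  continuous_clm_apply.2 h

open scoped MatrixOrder in
/-- The positive semidefinite square root of a positive semidefinite matrix. -/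
noncomputable def Matrix.psdSqrt (A : CMat n) : CMat n := CFC.sqrt A

open scoped MatrixOrder Matrix.Norms.L2Operator in
theorem Matrix.continuous_psdSqrt {X : Type*} [TopologicalSpace X] {g : X → CMat n}
    (hg : Continuous g) (hp : ∀ x, (g x).PosSemidef) : Continuous fun x => psdSqrt (g x) :=
  CFC.continuousOn_sqrt.comp_continuous hg fun x => (hp x).nonneg

/-! ### Perron–Frobenius theory of the scaling operator -/

/-- The operator whose fixed rays are the squares of the right scaling matrices of `E`. -/
noncomputable def scalingOperator (E : CMatMap n) (P : CMat n) : CMat n :=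
  (hsAdjoint E (E P)⁻¹)⁻¹

namespace IsPositivityImproving

variable [Nonempty (Fin n)] {E : CMatMap n} (h : IsPositivityImproving E)
include h

theorem hsAdjoint_inv_posDef {P : CMat n} (hP : P.PosSemidef) (h0 : P ≠ 0) :
    (hsAdjoint E (E P)⁻¹).PosDef := h.hsAdjoint_posDef (h P hP h0).inv

theorem scalingOperator_posDef {P : CMat n} (hP : P.PosSemidef) (h0 : P ≠ 0) :
    (scalingOperator E P).PosDef := (h.hsAdjoint_inv_posDef hP h0).inv

theorem scalingOperator_smul {P : CMat n} (hP : P.PosSemidef) (h0 : P ≠ 0) {t : ℝ} (ht : 0 < t) :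
    scalingOperator E ((t : ℂ) • P) = (t : ℂ) • scalingOperator E P := by
  have htc : (t : ℂ) ≠ 0 := by exact_mod_cast ht.ne'
  have h1 := (isUnit_iff_isUnit_det _).1 (h P hP h0).isUnit
  have h2 := (isUnit_iff_isUnit_det _).1 (h.hsAdjoint_inv_posDef hP h0).isUnit
  have hinv : ∀ {c : ℂ} {A : CMat n}, c ≠ 0 → IsUnit A.det → (c • A)⁻¹ = c⁻¹ • A⁻¹ := by
    intro c A hc hA
    exact Matrix.inv_smul' (A := A) (Units.mk0 c hc) hA
  rw [scalingOperator, map_smul, hinv htc h1, hsAdjoint_smul, hinv (inv_ne_zero htc) h2, inv_inv,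
    scalingOperator]

/-- `E` turns a nonzero semidefinite gap into a definite one, `E*` preserves definiteness, and the
two order-reversing inversions cancel. -/
theorem scalingOperator_strictMono {P Q : CMat n} (hP : P.PosSemidef) (h0 : P ≠ 0)
    (hQ : Q.PosSemidef) (hPQ : (Q - P).PosSemidef) (hne : Q ≠ P) :
    (scalingOperator E Q - scalingOperator E P).PosDef := by
  have hQ0 : Q ≠ 0 := by
    rintro rfl
    have h1 := hPQ.trace_nonneg
    have h2 : P.trace = 0 := le_antisymm (by simpa using h1) hP.trace_nonneg
    exact h0 (hP.trace_eq_zero_iff.1 h2)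
  have h1 : (E Q - E P).PosDef := by
    rw [← map_sub]; exact h _ hPQ (sub_ne_zero.2 hne)
  have h2 := h.hsAdjoint_posDef ((h P hP h0).inv_sub_inv h1)
  rw [hsAdjoint_sub] at h2
  exact (h.hsAdjoint_inv_posDef hQ hQ0).inv_sub_inv h2

/-- Take the least `M` with `P ≤ M Q`. If equality failed, applying the operator would make the
inequality strict, so `M` could be lowered. -/
theorem scalingOperator_fixed_unique {P Q : CMat n} (hP : P.PosDef) (hQ : Q.PosDef)
    (hfP : scalingOperator E P = P) (hfQ : scalingOperator E Q = Q) :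
    ∃ s : ℝ, 0 < s ∧ P = (s : ℂ) • Q := by
  have hP0 : P ≠ 0 := fun h0 => by simpa [h0] using hP.trace_pos
  have hQ0 : Q ≠ 0 := fun h0 => by simpa [h0] using hQ.trace_pos
  have hpos : ∀ M : ℝ, ((M : ℂ) • Q - P).PosSemidef → 0 < M := by
    intro M hM
    have h1 := hM.trace_nonneg
    rw [trace_sub, trace_smul, sub_nonneg, smul_eq_mul] at h1
    have h2 := hP.trace_pos.trans_le h1
    exact_mod_cast pos_of_mul_pos_left h2 hQ.trace_pos.le
  let S : Set ℝ := {M | ((M : ℂ) • Q - P).PosSemidef}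
  have hS : IsClosed S := isClosed_posSemidef.preimage (f := fun M : ℝ => (M : ℂ) • Q - P)
    (by fun_prop)
  have hSn : S.Nonempty := by
    obtain ⟨ε, hε, hE⟩ := hQ.exists_pos_sub_smul_posSemidef hP.isHermitian
    refine ⟨ε⁻¹, ?_⟩
    have h1 := hE.smul (a := ((ε⁻¹ : ℝ) : ℂ)) (by exact_mod_cast (inv_pos.2 hε).le)
    have h2 : (ε : ℂ) ≠ 0 := by exact_mod_cast hε.ne'
    change (((ε⁻¹ : ℝ) : ℂ) • Q - P).PosSemidef
    simpa only [smul_sub, smul_smul, Complex.ofReal_inv, inv_mul_cancel₀ h2, one_smul] using h1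
  have hSb : BddBelow S := ⟨0, fun M hM => (hpos M hM).le⟩
  have hm : (((sInf S : ℝ) : ℂ) • Q - P).PosSemidef := hS.csInf_mem hSn hSb
  refine ⟨sInf S, hpos _ hm, ?_⟩
  by_contra hne
  have hs := h.scalingOperator_strictMono hP.posSemidef hP0
    (hQ.smul_ofReal (hpos _ hm)).posSemidef hm (Ne.symm hne)
  rw [h.scalingOperator_smul hQ.posSemidef hQ0 (hpos _ hm), hfP, hfQ] at hs
  obtain ⟨ε, hε, hE⟩ := hs.exists_pos_sub_smul_posSemidef hQ.isHermitian
  have : sInf S - ε ∈ S := by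
    change (((sInf S - ε : ℝ) : ℂ) • Q - P).PosSemidef
    convert hE using 1
    push_cast
    rw [sub_smul]; abel
  linarith [csInf_le hSb this]

omit h [Nonempty (Fin n)] in
theorem continuous_hsAdjoint_inv : Continuous fun p : PosImprovingMap n × DensityMatrix n =>
    hsAdjoint p.1.1 (p.1.1 p.2.1)⁻¹ := by
  refine continuous_hsAdjoint (by fun_prop) (continuous_inv_of_isUnit ?_ fun p => ?_)
  · exact CMatMap.continuous_apply (by fun_prop) (by fun_prop)
  · exact (p.1.2 _ p.2.2.1 p.2.ne_zero).isUnit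

theorem continuous_scalingOperator :
    Continuous fun P : DensityMatrix n => scalingOperator E P.1 :=
  continuous_inv_of_isUnit
    (continuous_hsAdjoint_inv.comp (f := fun P : DensityMatrix n => ((⟨E, h⟩, P) :
      PosImprovingMap n × DensityMatrix n)) (by fun_prop))
    fun P => (h.hsAdjoint_inv_posDef P.2.1 P.ne_zero).isUnit

/-- By adjointness `tr(P E*(E(P)⁻¹)) = tr(E(P) E(P)⁻¹) = n`, while the eigenvalue equation makes `r`
times this trace equal to `n`. -/
theorem eigenvalue_eq_one {P : CMat n} (hP : P.PosDef) {r : ℝ}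
    (hPr : scalingOperator E P = (r : ℂ) • P) : r = 1 := by
  have hP0 : P ≠ 0 := fun h0 => by simpa [h0] using hP.trace_pos
  have hu := (isUnit_iff_isUnit_det _).1 (h.hsAdjoint_inv_posDef hP.posSemidef hP0).isUnit
  have hu2 := (isUnit_iff_isUnit_det _).1 (h.posDef_of_posDef hP).isUnit
  have h1 : (r : ℂ) • (P * hsAdjoint E (E P)⁻¹) = 1 := by
    rw [← Matrix.smul_mul, ← hPr, scalingOperator, Matrix.nonsing_inv_mul _ hu]
  have h2 := trace_hsAdjoint E P (E P)⁻¹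
  rw [hP.isHermitian.eq, (h.posDef_of_posDef hP).isHermitian.eq, Matrix.mul_nonsing_inv _ hu2] at h2
  have h3 := congrArg Matrix.trace h1
  rw [trace_smul, h2, smul_eq_mul] at h3
  have h4 : (Matrix.trace (1 : CMat n)) ≠ 0 := (PosDef.one (n := Fin n) (R := ℂ)).trace_pos.ne'
  exact_mod_cast (mul_eq_right₀ h4).1 h3

/-- Collatz–Wielandt argument: at the minimal `r` with `T(P) ≤ r P`, equality must hold, since
otherwise `T(P)` itself admits a smaller `r`. -/
theorem exists_scalingOperator_fixed :
    ∃ P : DensityMatrix n, P.1.PosDef ∧ scalingOperator E P.1 = P.1 := by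
  have hnorm : ∀ A : CMat n, A.PosDef → ∃ t : ℝ, 0 < t ∧ ((t : ℂ) • A).trace = 1 := by
    intro A hA
    obtain ⟨h1, h2⟩ := Complex.pos_iff.1 hA.trace_pos
    have h3 : A.trace = (A.trace.re : ℂ) := Complex.ext rfl (by simpa using h2.symm)
    refine ⟨A.trace.re⁻¹, inv_pos.2 h1, ?_⟩
    have h4 : (A.trace.re : ℂ) ≠ 0 := by exact_mod_cast h1.ne'
    rw [trace_smul, smul_eq_mul, h3]
    push_cast
    exact inv_mul_cancel₀ h4
  have hpos : ∀ (P : DensityMatrix n) (r : ℝ),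
      ((r : ℂ) • P.1 - scalingOperator E P.1).PosSemidef → 0 < r := by
    intro P r hr
    have h1 := hr.trace_nonneg
    rw [trace_sub, trace_smul, sub_nonneg, P.2.2, smul_eq_mul, mul_one] at h1
    exact_mod_cast (h.scalingOperator_posDef P.2.1 P.ne_zero).trace_pos.trans_le h1
  obtain ⟨t, ht, ht1⟩ := hnorm 1 PosDef.one
  let P₀ : DensityMatrix n := ⟨(t : ℂ) • 1, (PosDef.one.smul_ofReal ht).posSemidef, ht1⟩
  obtain ⟨R, hR⟩ : ∃ R : ℝ, ((R : ℂ) • P₀.1 - scalingOperator E P₀.1).PosSemidef := by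
    obtain ⟨ε, hε, hE⟩ := (PosDef.one.smul_ofReal ht).exists_pos_sub_smul_posSemidef
      (h.scalingOperator_posDef P₀.2.1 P₀.ne_zero).isHermitian
    refine ⟨ε⁻¹, ?_⟩
    have h1 := hE.smul (a := ((ε⁻¹ : ℝ) : ℂ)) (by exact_mod_cast (inv_pos.2 hε).le)
    have h2 : (ε : ℂ) ≠ 0 := by exact_mod_cast hε.ne'
    simpa only [smul_sub, smul_smul, Complex.ofReal_inv, inv_mul_cancel₀ h2, one_smul, P₀] using h1
  -- Capping `r` at the value `R` attained by `P₀` makes the domain compact.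
  let C : Set (DensityMatrix n × Set.Icc 0 R) :=
    {p | ((p.2.1 : ℂ) • p.1.1 - scalingOperator E p.1.1).PosSemidef}
  have hC : IsClosed C := by
    refine isClosed_posSemidef.preimage
      (f := fun p : DensityMatrix n × Set.Icc 0 R =>
        (p.2.1 : ℂ) • p.1.1 - scalingOperator E p.1.1) (Continuous.sub (by fun_prop) ?_)
    exact h.continuous_scalingOperator.comp continuous_fst
  have hCn : C.Nonempty := ⟨(P₀, ⟨R, (hpos _ _ hR).le, le_rfl⟩), hR⟩
  obtain ⟨⟨P, r⟩, hPr, hmin⟩ := hC.isCompact.exists_isMinOn hCn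
    (f := fun p => (p.2.1 : ℝ)) (by fun_prop)
  have hPr : (((r : ℝ) : ℂ) • P.1 - scalingOperator E P.1).PosSemidef := hPr
  have hr : 0 < r.1 := hpos _ _ hPr
  have hT := h.scalingOperator_posDef P.2.1 P.ne_zero
  have hT0 : scalingOperator E P.1 ≠ 0 := fun h0 => by simpa [h0] using hT.trace_pos
  have heq : scalingOperator E P.1 = ((r : ℝ) : ℂ) • P.1 := by
    by_contra hne
    have hs := h.scalingOperator_strictMono hT.posSemidef hT0
      (P.2.1.smul (a := ((r : ℝ) : ℂ)) (by exact_mod_cast hr.le)) hPr (Ne.symm hne)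
    rw [h.scalingOperator_smul P.2.1 P.ne_zero hr] at hs
    obtain ⟨ε, hε, hE⟩ := hs.exists_pos_sub_smul_posSemidef hT.isHermitian
    obtain ⟨s, hs, hs1⟩ := hnorm _ hT
    -- The competitor is `T(P)` normalized to trace one; it achieves `r - ε`.
    let P' : DensityMatrix n := ⟨_, (hT.smul_ofReal hs).posSemidef, hs1⟩
    have h1 : (((r.1 - ε : ℝ) : ℂ) • P'.1 - scalingOperator E P'.1).PosSemidef := by
      have h2 := hE.smul (a := (s : ℂ)) (by exact_mod_cast hs.le)
      change (((r.1 - ε : ℝ) : ℂ) • ((s : ℂ) • scalingOperator E P.1)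
        - scalingOperator E ((s : ℂ) • scalingOperator E P.1)).PosSemidef
      rw [h.scalingOperator_smul hT.posSemidef hT0 hs]
      convert h2 using 1
      push_cast
      module
    have h2 := hmin (a := (P', ⟨r.1 - ε, (hpos _ _ h1).le, by linarith [r.2.2]⟩)) h1
    change r.1 ≤ r.1 - ε at h2
    linarith
  have hP : P.1.PosDef := by
    have h1 : P.1 = ((r.1⁻¹ : ℝ) : ℂ) • scalingOperator E P.1 := by
      have h2 : ((r : ℝ) : ℂ) ≠ 0 := by exact_mod_cast hr.ne'
      rw [heq, smul_smul]; push_cast; rw [inv_mul_cancel₀ h2, one_smul]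
    rw [h1]
    exact hT.smul_ofReal (inv_pos.2 hr)
  refine ⟨P, hP, ?_⟩
  rw [heq, h.eigenvalue_eq_one hP heq, Complex.ofReal_one, one_smul]

end IsPositivityImproving

/-! ### From fixed points to scalings -/

theorem Matrix.mul_conjTranspose_eq_inv {M Y : CMat n} (h : Yᴴ * M * Y = 1) :
    Y * Yᴴ = M⁻¹ := by
  have h1 : Y * (Yᴴ * M) = 1 := mul_eq_one_comm.1 h
  exact (Matrix.inv_eq_left_inv (by rw [Matrix.mul_assoc, h1])).symm

theorem Matrix.conjTranspose_mul_mul_eq_one {M Y : CMat n} (hM : IsUnit M) (h : Y * Yᴴ = M⁻¹) :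
    Yᴴ * M * Y = 1 := by
  refine mul_eq_one_comm.1 ?_
  rw [← Matrix.mul_assoc, h, Matrix.nonsing_inv_mul _ ((isUnit_iff_isUnit_det _).1 hM)]

/-- Polar decomposition with a prescribed positive definite factor. -/
theorem Matrix.PosDef.exists_unitary_mul_eq {Z W : CMat n} (hZ : Z.PosDef) (h : W * Wᴴ = Z * Z) :
    ∃ U ∈ unitaryGroup (Fin n) ℂ, W = Z * U := by
  have hu := (isUnit_iff_isUnit_det _).1 hZ.isUnit
  refine ⟨Z⁻¹ * W, ?_, by rw [← Matrix.mul_assoc, Matrix.mul_nonsing_inv _ hu, Matrix.one_mul]⟩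
  rw [mem_unitaryGroup_iff, star_eq_conjTranspose, conjTranspose_mul, hZ.inv.isHermitian.eq]
  calc Z⁻¹ * W * (Wᴴ * Z⁻¹) = Z⁻¹ * (W * Wᴴ) * Z⁻¹ := by simp only [Matrix.mul_assoc]
    _ = (Z⁻¹ * Z) * (Z * Z⁻¹) := by rw [h]; simp only [Matrix.mul_assoc]
    _ = 1 := by
      rw [Matrix.nonsing_inv_mul _ hu, Matrix.mul_nonsing_inv _ hu, Matrix.one_mul]

open scoped MatrixOrder in
theorem Matrix.PosDef.psdSqrt_posDef {A : CMat n} (hA : A.PosDef) : (psdSqrt A).PosDef :=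
  isStrictlyPositive_iff_posDef.1 (IsStrictlyPositive.sqrt A (isStrictlyPositive_iff_posDef.2 hA))

open scoped MatrixOrder in
theorem Matrix.PosDef.psdSqrt_mul_psdSqrt {A : CMat n} (hA : A.PosDef) :
    psdSqrt A * psdSqrt A = A :=
  CFC.sqrt_mul_sqrt_self A hA.posSemidef.nonneg

theorem continuous_scaleMap {Z : Type*} [TopologicalSpace Z] {f : Z → CMatMap n}
    {X Y : Z → CMat n} (hf : Continuous f) (hX : Continuous X) (hY : Continuous Y) :
    Continuous fun z => scaleMap (f z) (X z) (Y z) := by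
  refine CMatMap.continuous_of_apply fun A => ?_
  change Continuous fun z => (Y z)ᴴ * f z (X z * A * (X z)ᴴ) * Y z
  exact (hY.matrix_conjTranspose.matrix_mul (CMatMap.continuous_apply hf (by fun_prop))).matrix_mul hY

theorem IsPositivityImproving.isPositiveMap {E : CMatMap n} (h : IsPositivityImproving E) :
    IsPositiveMap E := by
  intro A hA
  rcases eq_or_ne A 0 with rfl | h0
  · rw [map_zero]; exact PosSemidef.zero
  · exact (h A hA h0).posSemidef

theorem IsPositiveMap.scaleMap {E : CMatMap n} (h : IsPositiveMap E) (X Y : CMat n) :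
    IsPositiveMap (scaleMap E X Y) := fun _ hA =>
  (h _ (hA.mul_mul_conjTranspose_same X)).conjTranspose_mul_mul_same Y

/-- The conditions `Yᴴ E(X Xᴴ) Y = 1` and `Xᴴ E*(Y Yᴴ) X = 1` determine `Y Yᴴ` and `X Xᴴ` as
inverses; eliminating `Y Yᴴ` leaves the fixed-point equation. -/
theorem isDoublyStochasticMap_scaleMap_iff [Nonempty (Fin n)] {E : CMatMap n}
    (h : IsPositivityImproving E) {X Y : CMat n} :
    IsDoublyStochasticMap (scaleMap E X Y) ↔
      (X * Xᴴ).PosDef ∧ scalingOperator E (X * Xᴴ) = X * Xᴴ ∧ Y * Yᴴ = (E (X * Xᴴ))⁻¹ := by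
  have e1 : scaleMap E X Y 1 = Yᴴ * E (X * Xᴴ) * Y := by
    change Yᴴ * E (X * 1 * Xᴴ) * Y = _
    rw [Matrix.mul_one]
  have e2 : hsAdjoint (scaleMap E X Y) 1 = Xᴴ * hsAdjoint E (Y * Yᴴ) * X := by
    rw [hsAdjoint_scaleMap, Matrix.mul_one]
  constructor
  · intro hD
    have h1 := hD.map_one
    have h2 := hD.adjoint_one
    rw [e1] at h1
    rw [e2] at h2
    have hY := mul_conjTranspose_eq_inv h1
    have hX := mul_conjTranspose_eq_inv h2
    have hXu : IsUnit X := IsUnit.of_mul_eq_one_right _ h2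
    refine ⟨PosDef.mul_conjTranspose_self X (vecMul_injective_of_isUnit hXu), ?_, hY⟩
    rw [scalingOperator, ← hY, ← hX]
  · rintro ⟨hP, hT, hY⟩
    have hE := h.posDef_of_posDef hP
    refine ⟨h.isPositiveMap.scaleMap X Y, ?_, ?_⟩
    · rw [e1]
      exact conjTranspose_mul_mul_eq_one hE.isUnit hY
    · rw [e2, hY]
      exact conjTranspose_mul_mul_eq_one (h.hsAdjoint_posDef hE.inv).isUnit hT.symm

theorem exists_continuous_scalingOperator_fixed [Nonempty (Fin n)] :
    ∃ P : PosImprovingMap n → DensityMatrix n, Continuous P ∧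
      ∀ E, (P E).1.PosDef ∧ scalingOperator E.1 (P E).1 = (P E).1 := by
  choose P hP hT using fun E : PosImprovingMap n => E.2.exists_scalingOperator_fixed
  refine ⟨P, continuous_of_isClosed_graph_of_compactSpace ?_, fun E => ⟨hP E, hT E⟩⟩
  -- By uniqueness the fixed-point equation alone cuts out the graph. Any density matrix solving it
  -- is automatically positive definite.
  have hg : {p : PosImprovingMap n × DensityMatrix n | P p.1 = p.2}
      = {p | hsAdjoint p.1.1 (p.1.1 p.2.1)⁻¹ * p.2.1 = 1} := by
    ext ⟨E, Q⟩
    have hu : ∀ Q : DensityMatrix n, IsUnit (hsAdjoint E.1 (E.1 Q.1)⁻¹).det := fun Q =>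
      (isUnit_iff_isUnit_det _).1 (E.2.hsAdjoint_inv_posDef Q.2.1 Q.ne_zero).isUnit
    constructor
    · intro hPQ
      obtain rfl : P E = Q := hPQ
      change hsAdjoint E.1 (E.1 (P E).1)⁻¹ * (P E).1 = 1
      nth_rw 2 [← hT E]
      exact Matrix.mul_nonsing_inv _ (hu _)
    · intro hQ
      have hQT : scalingOperator E.1 Q.1 = Q.1 := Matrix.inv_eq_right_inv hQ
      have hQP : Q.1.PosDef := by
        rw [← hQT]; exact E.2.scalingOperator_posDef Q.2.1 Q.ne_zero
      obtain ⟨s, -, hs⟩ := E.2.scalingOperator_fixed_unique (hP E) hQP (hT E) hQT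
      have h1 := congrArg Matrix.trace hs
      rw [trace_smul, (P E).2.2, Q.2.2, smul_eq_mul, mul_one] at h1
      exact Subtype.ext (by rw [hs, ← h1, one_smul])
  rw [hg]
  exact isClosed_eq (IsPositivityImproving.continuous_hsAdjoint_inv.matrix_mul (by fun_prop))
    continuous_const

theorem exists_scaling_eq_smul [Nonempty (Fin n)] {E : CMatMap n} (h : IsPositivityImproving E)
    {X Y X' Y' : CMat n} (hD : IsDoublyStochasticMap (scaleMap E X Y))
    (hD' : IsDoublyStochasticMap (scaleMap E X' Y')) : ∃ t : ℝ, 0 < t ∧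
      X' * X'ᴴ = ((t : ℂ) • X) * ((t : ℂ) • X)ᴴ ∧
      Y' * Y'ᴴ = ((t⁻¹ : ℂ) • Y) * ((t⁻¹ : ℂ) • Y)ᴴ := by
  obtain ⟨hP, hT, hY⟩ := (isDoublyStochasticMap_scaleMap_iff h).1 hD
  obtain ⟨hP', hT', hY'⟩ := (isDoublyStochasticMap_scaleMap_iff h).1 hD'
  obtain ⟨s, hs, hss⟩ := h.scalingOperator_fixed_unique hP' hP hT' hT
  -- The fixed points `X Xᴴ` are quadratic in `X`, so the scalar on `X` is `√s`.
  obtain ⟨t, ht, rfl⟩ : ∃ t : ℝ, 0 < t ∧ t * t = s :=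
    ⟨√s, Real.sqrt_pos.2 hs, Real.mul_self_sqrt hs.le⟩
  have htc : (t : ℂ) ≠ 0 := by exact_mod_cast ht.ne'
  refine ⟨t, ht, ?_, ?_⟩
  · rw [hss, Complex.ofReal_mul]
    simp only [conjTranspose_smul, Complex.star_def, Complex.conj_ofReal, Matrix.smul_mul,
      Matrix.mul_smul, smul_smul]
  · have hu := (isUnit_iff_isUnit_det _).1 (h.posDef_of_posDef hP).isUnit
    rw [hY', hss, map_smul]
    have h1 := Matrix.inv_smul' (A := E (X * Xᴴ)) (Units.mk0 _ (mul_ne_zero htc htc)) hu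
    push_cast
    refine h1.trans ?_
    rw [← hY]
    simp [conjTranspose_smul, smul_smul, Units.smul_def]

theorem exists_continuous_posDef_scaling [Nonempty (Fin n)] :
    ∃ X Y : PosImprovingMap n → CMat n, Continuous X ∧ Continuous Y ∧
      ∀ E, (X E).PosDef ∧ (Y E).PosDef ∧ IsDoublyStochasticMap (scaleMap E.1 (X E) (Y E)) := by
  obtain ⟨P, hPc, hP⟩ := exists_continuous_scalingOperator_fixed (n := n)
  have hQ : ∀ E : PosImprovingMap n, (E.1 (P E).1)⁻¹.PosDef := fun E =>
    (E.2.posDef_of_posDef (hP E).1).inv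
  have hX : Continuous fun E : PosImprovingMap n => psdSqrt (P E).1 :=
    continuous_psdSqrt (by fun_prop) fun E => (hP E).1.posSemidef
  have hY : Continuous fun E : PosImprovingMap n => psdSqrt (E.1 (P E).1)⁻¹ :=
    continuous_psdSqrt (continuous_inv_of_isUnit
      (CMatMap.continuous_apply continuous_subtype_val (by fun_prop))
      fun E => (E.2.posDef_of_posDef (hP E).1).isUnit) fun E => (hQ E).posSemidef
  have hXp : ∀ E, (psdSqrt (P E).1).PosDef := fun E => (hP E).1.psdSqrt_posDef
  have hYp : ∀ E : PosImprovingMap n, (psdSqrt (E.1 (P E).1)⁻¹).PosDef :=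
    fun E => (hQ E).psdSqrt_posDef
  have hD : ∀ E : PosImprovingMap n, IsDoublyStochasticMap
      (scaleMap E.1 (psdSqrt (P E).1) (psdSqrt (E.1 (P E).1)⁻¹)) := by
    intro E
    rw [isDoublyStochasticMap_scaleMap_iff E.2, (hXp E).isHermitian.eq, (hYp E).isHermitian.eq,
      (hP E).1.psdSqrt_mul_psdSqrt, (hQ E).psdSqrt_mul_psdSqrt]
    exact ⟨(hP E).1, (hP E).2, rfl⟩
  exact ⟨_, _, hX, hY, fun E => ⟨hXp E, hYp E, hD E⟩⟩

theorem eq_smul_of_isDoublyStochasticMap_scaleMap [Nonempty (Fin n)] {E : CMatMap n}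
    (h : IsPositivityImproving E) {X Y X' Y' : CMat n} (hX : X.PosDef) (hY : Y.PosDef)
    (hD : IsDoublyStochasticMap (scaleMap E X Y)) (hX' : X'.PosDef) (hY' : Y'.PosDef)
    (hD' : IsDoublyStochasticMap (scaleMap E X' Y')) :
    scaleMap E X' Y' = scaleMap E X Y ∧
      ∃ t : ℝ, 0 < t ∧ X' = (t : ℂ) • X ∧ Y' = (t⁻¹ : ℂ) • Y := by
  obtain ⟨t, ht, h1, h2⟩ := exists_scaling_eq_smul h hD hD'
  have hXt := hX.smul_ofReal ht
  have hYt := hY.smul_ofReal (inv_pos.2 ht)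
  rw [Complex.ofReal_inv] at hYt
  rw [hXt.isHermitian.eq, hX'.isHermitian.eq] at h1
  rw [hYt.isHermitian.eq, hY'.isHermitian.eq] at h2
  have hX1 := hX'.posSemidef.eq_of_mul_self_eq hXt.posSemidef h1
  have hY1 := hY'.posSemidef.eq_of_mul_self_eq hYt.posSemidef h2
  exact ⟨by rw [hX1, hY1, scaleMap_smul _ _ _ ht.ne'], t, ht, hX1, hY1⟩

theorem eq_smul_mul_unitary_of_isDoublyStochasticMap_scaleMap [Nonempty (Fin n)] {E : CMatMap n}
    (h : IsPositivityImproving E) {X Y X' Y' : CMat n} (hX : X.PosDef) (hY : Y.PosDef)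
    (hD : IsDoublyStochasticMap (scaleMap E X Y))
    (hD' : IsDoublyStochasticMap (scaleMap E X' Y')) :
    ∃ (t : ℝ) (U V : CMat n), 0 < t ∧
      U ∈ Matrix.unitaryGroup (Fin n) ℂ ∧ V ∈ Matrix.unitaryGroup (Fin n) ℂ ∧
      X' = (t : ℂ) • (X * U) ∧ Y' = (t⁻¹ : ℂ) • (Y * V) ∧
      scaleMap E X' Y' = scaleMap (scaleMap E X Y) U V := by
  obtain ⟨t, ht, h1, h2⟩ := exists_scaling_eq_smul h hD hD'
  have hXt := hX.smul_ofReal ht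
  have hYt := hY.smul_ofReal (inv_pos.2 ht)
  rw [Complex.ofReal_inv] at hYt
  rw [hXt.isHermitian.eq] at h1
  rw [hYt.isHermitian.eq] at h2
  obtain ⟨U, hU, hXU⟩ := hXt.exists_unitary_mul_eq h1
  obtain ⟨V, hV, hYV⟩ := hYt.exists_unitary_mul_eq h2
  rw [Matrix.smul_mul] at hXU hYV
  refine ⟨t, U, V, ht, hU, hV, hXU, hYV, ?_⟩
  rw [hXU, hYV, scaleMap_smul _ _ _ ht.ne', scaleMap_scaleMap]

end

theorem mainTheorem9 (n : ℕ) :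
    ∃ (S : PosImprovingMap n → CMatMap n) (X Y : PosImprovingMap n → CMat n),
      -- the doubly stochastic scaling and the scaling matrices depend continuously on the map
      Continuous S ∧ Continuous X ∧ Continuous Y ∧
      -- `S E` is the doubly stochastic scaling of `E`, by the positive definite `X E` and `Y E`
      (∀ E : PosImprovingMap n, (X E).PosDef ∧ (Y E).PosDef ∧
        S E = scaleMap E.1 (X E) (Y E) ∧ IsDoublyStochasticMap (S E)) ∧
      -- it is the only one by positive definite matrices, which are unique up to a scalar
      (∀ (E : PosImprovingMap n) (X' Y' : CMat n), X'.PosDef → Y'.PosDef →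
        IsDoublyStochasticMap (scaleMap E.1 X' Y') →
          scaleMap E.1 X' Y' = S E ∧
            ∃ t : ℝ, 0 < t ∧ X' = (t : ℂ) • X E ∧ Y' = (t⁻¹ : ℂ) • Y E) ∧
      -- every scaling by arbitrary matrices differs from it by two unitaries
      (∀ (E : PosImprovingMap n) (X' Y' : CMat n),
        IsDoublyStochasticMap (scaleMap E.1 X' Y') →
          ∃ (t : ℝ) (U V : CMat n), 0 < t ∧
            U ∈ Matrix.unitaryGroup (Fin n) ℂ ∧ V ∈ Matrix.unitaryGroup (Fin n) ℂ ∧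
            X' = (t : ℂ) • (X E * U) ∧ Y' = (t⁻¹ : ℂ) • (Y E * V) ∧
            scaleMap E.1 X' Y' = scaleMap (S E) U V) := by
  rcases isEmpty_or_nonempty (Fin n) with hn | hn
  -- For `n = 0` no matrix has trace one, so this case is separate; all matrices coincide.
  · have hM : ∀ A B : CMat n, A = B := fun A B => Subsingleton.elim A B
    have hE : ∀ E F : CMatMap n, E = F := fun E F => ContinuousLinearMap.ext fun A => hM _ _
    have hp : ∀ A : CMat n, A.PosDef := fun A => hM 1 A ▸ PosDef.one
    refine ⟨fun _ => 0, fun _ => 1, fun _ => 1, continuous_const, continuous_const,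
      continuous_const, fun E => ⟨hp _, hp _, hE _ _, ?_⟩, fun E X' Y' _ _ _ => ?_,
      fun E X' Y' _ => ?_⟩
    · exact ⟨fun A _ => (hp _).posSemidef, hM _ _, hM _ _⟩
    · exact ⟨hE _ _, 1, one_pos, hM _ _, hM _ _⟩
    · exact ⟨1, 1, 1, one_pos, one_mem _, one_mem _, hM _ _, hM _ _, hE _ _⟩
  obtain ⟨X, Y, hX, hY, hXY⟩ := exists_continuous_posDef_scaling (n := n)
  have hS : Continuous fun E : PosImprovingMap n => scaleMap E.1 (X E) (Y E) :=
    continuous_scaleMap continuous_subtype_val hX hY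
  refine ⟨fun E => scaleMap E.1 (X E) (Y E), X, Y, hS, hX, hY,
    fun E => ⟨(hXY E).1, (hXY E).2.1, rfl, (hXY E).2.2⟩, ?_, ?_⟩
  · intro E X' Y' hX' hY' hD'
    exact eq_smul_of_isDoublyStochasticMap_scaleMap E.2 (hXY E).1 (hXY E).2.1 (hXY E).2.2 hX' hY' hD'
  · intro E X' Y' hD'
    exact eq_smul_mul_unitary_of_isDoublyStochasticMap_scaleMap E.2 (hXY E).1 (hXY E).2.1
      (hXY E).2.2 hD'
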